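/- Let $\Omega\subset\mathbb R^d$ be open and simply connected with Lipschitz-continuous boundary $\Gamma$. Let $\Gamma=\Gamma_D\cup\Gamma_N$, where $\Gamma_D\subset\Gamma$ is closed and of positive surface measure and $\Gamma_N=\Gamma\setminus\Gamma_D$. Let $V_0$ be the space of all $w\in H^1(\Omega)$ with zero trace on $\Gamma_D$, and let $c_\Omega,c_{\Gamma_N}>0$ be constants such that $$\|w\|_{L^2(\Omega)}\le c_\Omega\|\nabla w\|_{L^2(\Omega,\mathbb R^d)},\qquad \|w\|_{L^2(\Gamma_N)}\le c_{\Gamma_N}\|\nabla w\|_{L^2(\Omega,\mathbb R^d)}\qquad\text{for all } w\in V_0 .$$ Let $H$ be the space of all $\tau\in H(\mathrm{div},\Omega)$ whose normal flux $\frac{\partial\tau}{\partial n}=\tau\cdot n$ on $\Gamma_N$, defined by $\int_\Omega(\tau\cdot\nabla w+w\,\mathrm{div}\,\tau)\,dx=\int_{\Gamma_N}\frac{\partial\tau}{\partial n}\,w\,ds$ for all $w\in V_0$, belongs to $L^2(\Gamma_N)$. Let $\alpha>0$, $f\in L^2(\Omega)$, $g,v,u^d\in L^2(\Gamma_N)$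 and $q\in V_0$. For $\tau\in H$ and $\beta>0$ put $$R(\tau)^2=c_\Omega^2\|\mathrm{div}\,\tau+f\|_{L^2(\Omega)}^2+c_{\Gamma_N}^2\big\|\tfrac{\partial\tau}{\partial n}-g-v\big\|_{L^2(\Gamma_N)}^2,\qquad R(\tau)\ge 0,$$ $$\overline J(q,\tau,\beta)=(1+\beta)\|\tau-\nabla q\|_{L^2(\Omega,\mathbb R^d)}^2+\frac{1+\beta}{\beta}R(\tau)^2+\alpha\|v-u^d\|_{L^2(\Gamma_N)}^2 .$$ (a) For every $\beta>0$ there is exactly one $\hat\tau\in H$ such that for all $\xi\in H$ $$\beta(\hat\tau,\xi)_{L^2(\Omega,\mathbb R^d)}+c_\Omega^2(\mathrm{div}\,\hat\tau,\mathrm{div}\,\xi)_{L^2(\Omega)}+c_{\Gamma_N}^2\big(\tfrac{\partial\hat\tau}{\partial n},\tfrac{\partial\xi}{\partial n}\big)_{L^2(\Gamma_N)}=\beta(\nabla q,\xi)_{L^2(\Omega,\mathbb R^d)}-c_\Omega^2(f,\mathrm{div}\,\xi)_{L^2(\Omega)}+c_{\Gamma_N}^2\big(g+v,\tfrac{\partial\xi}{\partial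 n}\big)_{L^2(\Gamma_N)},$$ and $\overline J(q,\hat\tau,\beta)=\min_{\tau\in H}\overline J(q,\tau,\beta)$. (b) Let $\tau\in H$ with $\tau\ne\nabla q$, and put $\hat\beta=R(\tau)/\|\tau-\nabla q\|_{L^2(\Omega,\mathbb R^d)}$. If $R(\tau)\neq0$, then $\hat\beta>0$ and $\overline J(q,\tau,\hat\beta)=\min_{\beta>0}\overline J(q,\tau,\beta)$. If $R(\tau)=0$, then $\hat\beta=0$ and $\inf_{\beta>0}\overline J(q,\tau,\beta)=\lim_{\beta\to0+}\overline J(q,\tau,\beta)=\|\tau-\nabla q\|_{L^2(\Omega,\mathbb R^d)}^2+\alpha\|v-u^d\|_{L^2(\Gamma_N)}^2$. -/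

import Mathlib

open MeasureTheory Set Filter Topology
open scoped ENNReal NNReal ContDiff

noncomputable section

namespace BoundaryControl

/-- The Euclidean space `ℝᵈ`. -/
abbrev Space (d : ℕ) : Type := EuclideanSpace ℝ (Fin d)

/-- The boundary `∂Ω` is, near each of its points and after a rotation, the graph of a Lipschitz
function, with `Ω` lying strictly above the graph. Here `e` is the vertical direction, and
`y - ⟪e, y⟫ e` is the horizontal part of `y`. -/
def HasLipschitzBoundary {d : ℕ} (Ω : Set (Space d)) : Prop :=
  ∀ x ∈ frontier Ω, ∃ e : Space d, ‖e‖ = 1 ∧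
    ∃ (K : ℝ≥0) (h : Space d → ℝ), LipschitzWith K h ∧
      ∃ r > 0, ∀ y ∈ Metric.ball x r,
        (y ∈ Ω ↔ h (y - inner ℝ e y • e) < inner ℝ e y)

/-- The surface measure: the normalised `(d - 1)`-dimensional Hausdorff measure of `ℝᵈ`
(to be restricted to subsets of `∂Ω`). -/
def surfaceMeasure (d : ℕ) : Measure (Space d) :=
  Measure.euclideanHausdorffMeasure (d - 1)

/-- The Neumann part of the boundary, `Γ_N = ∂Ω \ Γ_D`. -/
def neumannPart {d : ℕ} (Ω ΓD : Set (Space d)) : Set (Space d) := frontier Ω \ ΓD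

/-- `L²(Ω)`. -/
abbrev L2 {d : ℕ} (Ω : Set (Space d)) : Type := Lp ℝ 2 (volume.restrict Ω)

/-- `L²(Ω, ℝᵈ)`. -/
abbrev L2Vec {d : ℕ} (Ω : Set (Space d)) : Type := Lp (Space d) 2 (volume.restrict Ω)

/-- `L²(Γ_N)`, with respect to the surface measure. -/
abbrev L2Neumann {d : ℕ} (Ω ΓD : Set (Space d)) : Type :=
  Lp ℝ 2 ((surfaceMeasure d).restrict (neumannPart Ω ΓD))

/-- `φ ∈ C_c^∞(Ω)`. -/
def IsTestFunction {d : ℕ} (Ω : Set (Space d)) (φ : Space d → ℝ) : Prop :=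
  ContDiff ℝ ∞ φ ∧ HasCompactSupport φ ∧ tsupport φ ⊆ Ω

/-- `G` is the weak gradient of `w` in `Ω`:
`∫_Ω w ∂_a φ = - ∫_Ω (G · a) φ` for all test functions `φ` and all directions `a`. -/
def HasWeakGradient {d : ℕ} (Ω : Set (Space d)) (w : L2 Ω) (G : L2Vec Ω) : Prop :=
  ∀ φ : Space d → ℝ, IsTestFunction Ω φ → ∀ a : Space d,
    ∫ x in Ω, w x * fderiv ℝ φ x a = - ∫ x in Ω, inner ℝ (G x) a * φ x

/-- `δ` is the weak divergence of `τ` in `Ω`: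
`∫_Ω τ · ∇φ = - ∫_Ω δ φ` for all test functions `φ`. -/
def HasWeakDivergence {d : ℕ} (Ω : Set (Space d)) (τ : L2Vec Ω) (δ : L2 Ω) : Prop :=
  ∀ φ : Space d → ℝ, IsTestFunction Ω φ →
    ∫ x in Ω, inner ℝ (τ x) (gradient φ x) = - ∫ x in Ω, δ x * φ x

/-- `t` is the boundary trace on `∂Ω` of the function `w ∈ H¹(Ω)` with weak gradient `G`: there are
smooth functions on the closure of `Ω` that converge to `w` in `H¹(Ω)` and whose boundary values
converge to `t` in `L²` of every bounded part of `∂Ω`. -/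
def IsTrace {d : ℕ} (Ω : Set (Space d)) (w : L2 Ω) (G : L2Vec Ω) (t : Space d → ℝ) : Prop :=
  AEStronglyMeasurable t ((surfaceMeasure d).restrict (frontier Ω)) ∧
  ∃ φ : ℕ → Space d → ℝ,
    (∀ n, ContDiff ℝ ∞ (φ n) ∧ HasCompactSupport (φ n)) ∧
    Tendsto (fun n => eLpNorm (fun x => φ n x - w x) 2 (volume.restrict Ω)) atTop (𝓝 0) ∧
    Tendsto (fun n => eLpNorm (fun x => gradient (φ n) x - G x) 2 (volume.restrict Ω))
      atTop (𝓝 0) ∧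
    ∀ K : Set (Space d), IsCompact K →
      Tendsto (fun n => eLpNorm (fun x => φ n x - t x) 2
        ((surfaceMeasure d).restrict (frontier Ω ∩ K))) atTop (𝓝 0)

/-- The space `V₀` of functions in `H¹(Ω)` with zero trace on `Γ_D`. An element is recorded together
with its weak gradient and its boundary trace, both of which it determines. -/
structure V0 {d : ℕ} (Ω ΓD : Set (Space d)) where
  val : L2 Ω
  grad : L2Vec Ω
  trace : Space d → ℝ
  hasWeakGradient : HasWeakGradient Ω val grad
  isTrace : IsTrace Ω val grad trace
  trace_eq_zero : ∀ᵐ x ∂((surfaceMeasure d).restrict ΓD), trace x = 0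

/-- The space of the fields `τ ∈ H(div, Ω)` whose normal flux `∂τ/∂n = τ · n` on `Γ_N` belongs to
`L²(Γ_N)`. The normal flux is the one given by Green's formula
`∫_Ω τ · ∇w + ∫_Ω (div τ) w = ∫_{Γ_N} (∂τ/∂n) w` for all `w ∈ V₀`.
An element is recorded together with its divergence and its normal flux, both of which it
determines. -/
@[ext]
structure HDivN {d : ℕ} (Ω ΓD : Set (Space d)) where
  field : L2Vec Ω
  div : L2 Ω
  flux : L2Neumann Ω ΓD
  hasWeakDivergence : HasWeakDivergence Ω field div
  green : ∀ w : V0 Ω ΓD,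
    inner ℝ field w.grad + inner ℝ div w.val
      = ∫ x in neumannPart Ω ΓD, flux x * w.trace x ∂(surfaceMeasure d)

/-- `‖w‖_{L²(Ω)} ≤ c ‖∇w‖_{L²(Ω)}` for all `w ∈ V₀`. -/
def IsFriedrichsConstant {d : ℕ} (Ω ΓD : Set (Space d)) (c : ℝ) : Prop :=
  ∀ w : V0 Ω ΓD, ‖w.val‖ ≤ c * ‖w.grad‖

/-- `‖w‖_{L²(Γ_N)} ≤ c ‖∇w‖_{L²(Ω)}` for all `w ∈ V₀`; in particular traces are in `L²(Γ_N)`. -/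
def IsTraceConstant {d : ℕ} (Ω ΓD : Set (Space d)) (c : ℝ) : Prop :=
  ∀ w : V0 Ω ΓD,
    eLpNorm w.trace 2 ((surfaceMeasure d).restrict (neumannPart Ω ΓD))
      ≤ ENNReal.ofReal (c * ‖w.grad‖)

variable {d : ℕ} {Ω ΓD : Set (Space d)}

/-- The weighted squared residual
`c_Ω² ‖div τ + f‖²_{L²(Ω)} + c_{Γ_N}² ‖∂τ/∂n - (g + v)‖²_{L²(Γ_N)}`. -/
def residualSq (cΩ cΓ : ℝ) (f : L2 Ω) (g v : L2Neumann Ω ΓD) (τ : HDivN Ω ΓD) : ℝ :=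
  cΩ ^ 2 * ‖τ.div + f‖ ^ 2 + cΓ ^ 2 * ‖τ.flux - (g + v)‖ ^ 2

/-- The functional `J̄(q, τ, β)`, the majorant plus the control cost. -/
def JUpper (cΩ cΓ α : ℝ) (f : L2 Ω) (g v ud : L2Neumann Ω ΓD)
    (q : V0 Ω ΓD) (τ : HDivN Ω ΓD) (β : ℝ) : ℝ :=
  (1 + β) * ‖τ.field - q.grad‖ ^ 2 + (1 + β) / β * residualSq cΩ cΓ f g v τ
    + α * ‖v - ud‖ ^ 2

/-- The variational equation for the optimal flux `τ̂`. -/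
def SolvesFluxProblem (cΩ cΓ : ℝ) (f : L2 Ω) (g v : L2Neumann Ω ΓD)
    (q : V0 Ω ΓD) (β : ℝ) (τ : HDivN Ω ΓD) : Prop :=
  ∀ ξ : HDivN Ω ΓD,
    β * inner ℝ τ.field ξ.field + cΩ ^ 2 * inner ℝ τ.div ξ.div
        + cΓ ^ 2 * inner ℝ τ.flux ξ.flux
      = β * inner ℝ q.grad ξ.field - cΩ ^ 2 * inner ℝ f ξ.div
        + cΓ ^ 2 * inner ℝ (g + v) ξ.flux

/-- The optimal parameter `β̂`, meaningful when `τ ≠ ∇q`. -/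
def betaHat (cΩ cΓ : ℝ) (f : L2 Ω) (g v : L2Neumann Ω ΓD)
    (q : V0 Ω ΓD) (τ : HDivN Ω ΓD) : ℝ :=
  √(residualSq cΩ cΓ f g v τ) / ‖τ.field - q.grad‖

end BoundaryControl

end

/-! For fixed `β`, up to the factor `(1 + β) / β` and an additive constant, the functional is the
squared distance from `(τ, div τ, ∂τ/∂n)` to the point `(∇q, -f, g + v)` in `L²(Ω, ℝᵈ) × L²(Ω) ×
L²(Γ_N)`, with weights `β, c_Ω², c_{Γ_N}²`. The variational equation says that `τ̂` is the
orthogonal projection of that point, so (a) is the projection theorem once the admissible triples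
form a closed subspace. They do, being the common kernel of continuous functionals: weak divergence
and Green's formula are linear identities tested against fixed `L²` elements
(`IsTraceConstant.exists_annihilator`). Minimality is Pythagoras.

For (b), put `N = ‖τ - ∇q‖` and complete the square: `(1 + β) N² + (1 + β) / β R² = (N + R)² + (β N
- R)² / β`. The last term vanishes exactly at `β = R / N`. If `R = 0`, the functional is affine in
`β`. -/

/-! ### Projection onto annihilators -/

/-- Orthogonal projection in a Hilbert space onto the vectors orthogonal to a given set. -/
theorem exists_projection_annihilator {E : Type*} [NormedAddCommGroup E] [InnerProductSpace ℝ E]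
    [CompleteSpace E] (S : Set E) (p : E) :
    ∃ x : E, (∀ s ∈ S, inner ℝ x s = 0) ∧
      ∀ z : E, (∀ s ∈ S, inner ℝ z s = 0) → inner ℝ x z = inner ℝ p z := by
  have mem_K (x : E) : x ∈ (Submodule.span ℝ S)ᗮ ↔ ∀ s ∈ S, inner ℝ x s = 0 := by
    rw [Submodule.mem_orthogonal']
    refine ⟨fun h s hs => h s (Submodule.subset_span hs), fun h u hu => ?_⟩
    induction hu using Submodule.span_induction with
    | mem s hs => exact h s hs
    | zero => simp
    | add s t _ _ hs ht => simp [inner_add_right, hs, ht]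
    | smul r s _ hs => simp [inner_smul_right, hs]
  obtain ⟨x, hx, y, hy, rfl⟩ := (Submodule.span ℝ S)ᗮ.exists_add_mem_mem_orthogonal p
  refine ⟨x, (mem_K x).1 hx, fun z hz => ?_⟩
  rw [inner_add_left, Submodule.inner_left_of_mem_orthogonal ((mem_K z).2 hz) hy, add_zero]

/-- Orthogonal projection in a weighted product of three Hilbert spaces onto the space of the
triples annihilated by a given set of functionals. -/
theorem exists_weighted_projection {H₁ H₂ H₃ : Type*}
    [NormedAddCommGroup H₁] [InnerProductSpace ℝ H₁] [CompleteSpace H₁]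
    [NormedAddCommGroup H₂] [InnerProductSpace ℝ H₂] [CompleteSpace H₂]
    [NormedAddCommGroup H₃] [InnerProductSpace ℝ H₃] [CompleteSpace H₃]
    (G : Set (H₁ × H₂ × H₃)) {a b c : ℝ} (ha : 0 < a) (hb : 0 < b) (hc : 0 < c)
    (p₁ : H₁) (p₂ : H₂) (p₃ : H₃) :
    ∃ (x₁ : H₁) (x₂ : H₂) (x₃ : H₃),
      (∀ y ∈ G, inner ℝ x₁ y.1 + inner ℝ x₂ y.2.1 + inner ℝ x₃ y.2.2 = 0) ∧
      ∀ (z₁ : H₁) (z₂ : H₂) (z₃ : H₃),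
        (∀ y ∈ G, inner ℝ z₁ y.1 + inner ℝ z₂ y.2.1 + inner ℝ z₃ y.2.2 = 0) →
        a ^ 2 * inner ℝ x₁ z₁ + b ^ 2 * inner ℝ x₂ z₂ + c ^ 2 * inner ℝ x₃ z₃
          = a ^ 2 * inner ℝ p₁ z₁ + b ^ 2 * inner ℝ p₂ z₂ + c ^ 2 * inner ℝ p₃ z₃ := by
  -- The scaling `(x₁, x₂, x₃) ↦ (a x₁, b x₂, c x₃)` turns the weighted inner product into the
  -- standard one of the `L²` product. Annihilation uses the unweighted pairing, so the functionals
  -- scale by the inverses.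
  let mk (x₁ : H₁) (x₂ : H₂) (x₃ : H₃) : WithLp 2 (H₁ × WithLp 2 (H₂ × H₃)) :=
    WithLp.toLp 2 (x₁, WithLp.toLp 2 (x₂, x₃))
  have inner_mk (x z : WithLp 2 (H₁ × WithLp 2 (H₂ × H₃))) : inner ℝ x z
      = inner ℝ x.fst z.fst + inner ℝ x.snd.fst z.snd.fst + inner ℝ x.snd.snd z.snd.snd := by
    simp [WithLp.prod_inner_apply, add_assoc]
  obtain ⟨x, hx, h⟩ := exists_projection_annihilator
    ((fun y : H₁ × H₂ × H₃ => mk (a⁻¹ • y.1) (b⁻¹ • y.2.1) (c⁻¹ • y.2.2)) '' G)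
    (mk (a • p₁) (b • p₂) (c • p₃))
  refine ⟨a⁻¹ • x.fst, b⁻¹ • x.snd.fst, c⁻¹ • x.snd.snd, fun y hy => ?_, fun z₁ z₂ z₃ hz => ?_⟩
  · have hxy := hx _ (mem_image_of_mem _ hy)
    rw [inner_mk] at hxy
    simpa only [mk, WithLp.toLp_fst, WithLp.toLp_snd, inner_smul_left, inner_smul_right,
      RCLike.conj_to_real] using hxy
  · have key := h (mk (a • z₁) (b • z₂) (c • z₃)) (by
      rintro _ ⟨y, hy, rfl⟩
      have hzy := hz y hy
      rw [inner_mk]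
      simp only [mk, WithLp.toLp_fst, WithLp.toLp_snd, inner_smul_left, inner_smul_right,
        RCLike.conj_to_real]
      field_simp
      exact hzy)
    rw [inner_mk, inner_mk] at key
    simp only [mk, WithLp.toLp_fst, WithLp.toLp_snd, inner_smul_left, inner_smul_right,
      RCLike.conj_to_real] at key ⊢
    field_simp
    linarith

namespace BoundaryControl

variable {d : ℕ} {Ω ΓD : Set (Space d)}

/-! ### The flux space as an annihilator -/

theorem IsTestFunction.memLp {φ : Space d → ℝ} (h : IsTestFunction Ω φ) :
    MemLp φ 2 (volume.restrict Ω) :=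
  h.1.continuous.memLp_of_hasCompactSupport h.2.1

theorem gradient_eq_toDual_symm_comp (φ : Space d → ℝ) :
    gradient φ = (InnerProductSpace.toDual ℝ (Space d)).symm ∘ fderiv ℝ φ := rfl

theorem IsTestFunction.gradient_memLp {φ : Space d → ℝ} (h : IsTestFunction Ω φ) :
    MemLp (gradient φ) 2 (volume.restrict Ω) := by
  rw [gradient_eq_toDual_symm_comp]
  refine Continuous.memLp_of_hasCompactSupport ?_ ?_
  · exact (LinearIsometryEquiv.continuous _).comp (h.1.continuous_fderiv (by simp))
  · exact (h.2.1.fderiv ℝ).comp_left (map_zero _)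

theorem hasWeakDivergence_iff {τ : L2Vec Ω} {δ : L2 Ω} :
    HasWeakDivergence Ω τ δ ↔ ∀ (φ : Space d → ℝ) (h : IsTestFunction Ω φ),
      inner ℝ τ h.gradient_memLp.toLp + inner ℝ δ h.memLp.toLp = 0 := by
  refine forall₂_congr fun φ h => ?_
  have h₁ : inner ℝ τ h.gradient_memLp.toLp = ∫ x in Ω, inner ℝ (τ x) (gradient φ x) := by
    rw [L2.inner_def]
    refine integral_congr_ae ?_
    filter_upwards [h.gradient_memLp.coeFn_toLp] with x hx
    rw [hx]
  have h₂ : inner ℝ δ h.memLp.toLp = ∫ x in Ω, δ x * φ x := by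
    rw [L2.inner_def]
    refine integral_congr_ae ?_
    filter_upwards [h.memLp.coeFn_toLp] with x hx
    simp [hx, mul_comm]
  rw [h₁, h₂, eq_neg_iff_add_eq_zero]

theorem IsTraceConstant.memLp_trace {c : ℝ} (hc : IsTraceConstant Ω ΓD c) (w : V0 Ω ΓD) :
    MemLp w.trace 2 ((surfaceMeasure d).restrict (neumannPart Ω ΓD)) :=
  ⟨w.isTrace.1.mono_measure (Measure.restrict_mono sdiff_subset le_rfl),
    (hc w).trans_lt ENNReal.ofReal_lt_top⟩

theorem IsTraceConstant.inner_trace {c : ℝ} (hc : IsTraceConstant Ω ΓD c) (w : V0 Ω ΓD)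
    (κ : L2Neumann Ω ΓD) :
    inner ℝ κ (hc.memLp_trace w).toLp
      = ∫ x in neumannPart Ω ΓD, κ x * w.trace x ∂(surfaceMeasure d) := by
  rw [L2.inner_def]
  refine integral_congr_ae ?_
  filter_upwards [(hc.memLp_trace w).coeFn_toLp] with x hx
  simp [hx, mul_comm]

/-- The triples `(τ, div τ, ∂τ/∂n)` form the annihilator of a set of functionals on
`L²(Ω, ℝᵈ) × L²(Ω) × L²(Γ_N)`. -/
theorem IsTraceConstant.exists_annihilator {c : ℝ} (hc : IsTraceConstant Ω ΓD c) :
    ∃ G : Set (L2Vec Ω × L2 Ω × L2Neumann Ω ΓD),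
      ∀ (τ : L2Vec Ω) (δ : L2 Ω) (κ : L2Neumann Ω ΓD),
        (∀ y ∈ G, inner ℝ τ y.1 + inner ℝ δ y.2.1 + inner ℝ κ y.2.2 = 0) ↔
          ∃ σ : HDivN Ω ΓD, σ.field = τ ∧ σ.div = δ ∧ σ.flux = κ := by
  -- Test functions encode the weak divergence and do not see the flux. Elements of `V₀` encode
  -- Green's formula, with the boundary integral moved to the left; the trace inequality makes the
  -- trace an element of `L²(Γ_N)`.
  refine ⟨{y | ∃ (φ : Space d → ℝ) (h : IsTestFunction Ω φ),
      y = (h.gradient_memLp.toLp, h.memLp.toLp, 0)} ∪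
    range fun w : V0 Ω ΓD => (w.grad, w.val, -(hc.memLp_trace w).toLp), fun τ δ κ => ⟨?_, ?_⟩⟩
  · intro h
    refine ⟨⟨τ, δ, κ, hasWeakDivergence_iff.2 fun φ hφ => ?_, fun w => ?_⟩, rfl, rfl, rfl⟩
    · simpa using h _ (Or.inl ⟨φ, hφ, rfl⟩)
    · have hw := h _ (Or.inr ⟨w, rfl⟩)
      rw [inner_neg_right, hc.inner_trace] at hw
      linarith
  · rintro ⟨σ, rfl, rfl, rfl⟩ y (⟨φ, hφ, rfl⟩ | ⟨w, rfl⟩)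
    · simpa using hasWeakDivergence_iff.1 σ.hasWeakDivergence φ hφ
    · have hw := σ.green w
      rw [inner_neg_right, hc.inner_trace]
      linarith

variable {cΩ cΓ α β : ℝ} {f : L2 Ω} {g v ud : L2Neumann Ω ΓD} {q : V0 Ω ΓD}

/-! ### Part (a): the optimal flux for fixed `β` -/

theorem exists_solvesFluxProblem {c : ℝ} (hc : IsTraceConstant Ω ΓD c) (hcΩ : 0 < cΩ)
    (hcΓ : 0 < cΓ) (hβ : 0 < β) (f : L2 Ω) (g v : L2Neumann Ω ΓD) (q : V0 Ω ΓD) :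
    ∃ τ : HDivN Ω ΓD, SolvesFluxProblem cΩ cΓ f g v q β τ := by
  obtain ⟨G, hG⟩ := hc.exists_annihilator
  -- The weights enter squared, hence `√β`.
  obtain ⟨x₁, x₂, x₃, hx, h⟩ := exists_weighted_projection G (Real.sqrt_pos.2 hβ) hcΩ hcΓ
    q.grad (-f) (g + v)
  obtain ⟨τ, rfl, rfl, rfl⟩ := (hG _ _ _).1 hx
  refine ⟨τ, fun ξ => ?_⟩
  have hξ := h _ _ _ ((hG _ _ _).2 ⟨ξ, rfl, rfl, rfl⟩)
  rw [Real.sq_sqrt hβ.le, inner_neg_left] at hξ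
  linarith

theorem SolvesFluxProblem.unique (hcΩ : 0 < cΩ) (hcΓ : 0 < cΓ) (hβ : 0 < β)
    {τ σ : HDivN Ω ΓD} (hτ : SolvesFluxProblem cΩ cΓ f g v q β τ)
    (hσ : SolvesFluxProblem cΩ cΓ f g v q β σ) : τ = σ := by
  have h : β * ‖τ.field - σ.field‖ ^ 2 + cΩ ^ 2 * ‖τ.div - σ.div‖ ^ 2
      + cΓ ^ 2 * ‖τ.flux - σ.flux‖ ^ 2 = 0 := by
    -- This is the difference of the two equations tested with `τ - σ`. As `HDivN` carries no
    -- subtraction, it is assembled from four instances.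
    simp only [← real_inner_self_eq_norm_sq, inner_sub_left, inner_sub_right]
    linarith [hτ τ, hτ σ, hσ τ, hσ σ]
  have h₁ : 0 ≤ β * ‖τ.field - σ.field‖ ^ 2 := by positivity
  have h₂ : 0 ≤ cΩ ^ 2 * ‖τ.div - σ.div‖ ^ 2 := by positivity
  have h₃ : 0 ≤ cΓ ^ 2 * ‖τ.flux - σ.flux‖ ^ 2 := by positivity
  have e₁ : β * ‖τ.field - σ.field‖ ^ 2 = 0 := by linarith
  have e₂ : cΩ ^ 2 * ‖τ.div - σ.div‖ ^ 2 = 0 := by linarith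
  have e₃ : cΓ ^ 2 * ‖τ.flux - σ.flux‖ ^ 2 = 0 := by linarith
  simp only [mul_eq_zero, hβ.ne', hcΩ.ne', hcΓ.ne', false_or, pow_eq_zero_iff, ne_eq,
    OfNat.ofNat_ne_zero, not_false_eq_true, norm_eq_zero, sub_eq_zero] at e₁ e₂ e₃
  exact HDivN.ext e₁ e₂ e₃

theorem JUpper_eq (hβ : 0 < β) (τ : HDivN Ω ΓD) :
    JUpper cΩ cΓ α f g v ud q τ β
      = (1 + β) / β * (β * ‖τ.field - q.grad‖ ^ 2 + residualSq cΩ cΓ f g v τ)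
        + α * ‖v - ud‖ ^ 2 := by
  unfold JUpper
  field_simp

theorem SolvesFluxProblem.JUpper_le (hβ : 0 < β) {τ : HDivN Ω ΓD}
    (hτ : SolvesFluxProblem cΩ cΓ f g v q β τ) (σ : HDivN Ω ΓD) :
    JUpper cΩ cΓ α f g v ud q τ β ≤ JUpper cΩ cΓ α f g v ud q σ β := by
  rw [JUpper_eq hβ, JUpper_eq hβ]
  -- Pythagoras: the cross term is the equation for `τ` tested with `σ - τ`, that is, its instance
  -- at `σ` minus its instance at `τ`.
  suffices h : β * ‖σ.field - q.grad‖ ^ 2 + residualSq cΩ cΓ f g v σ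
      = β * ‖τ.field - q.grad‖ ^ 2 + residualSq cΩ cΓ f g v τ
        + (β * ‖σ.field - τ.field‖ ^ 2 + cΩ ^ 2 * ‖σ.div - τ.div‖ ^ 2
          + cΓ ^ 2 * ‖σ.flux - τ.flux‖ ^ 2) by
    rw [h]
    refine add_le_add_left (mul_le_mul_of_nonneg_left ?_ (by positivity)) _
    exact le_add_of_nonneg_right (by positivity)
  have h₁ : σ.field - q.grad = (σ.field - τ.field) + (τ.field - q.grad) := by abel
  have h₂ : σ.div + f = (σ.div - τ.div) + (τ.div + f) := by abel
  have h₃ : σ.flux - (g + v) = (σ.flux - τ.flux) + (τ.flux - (g + v)) := by abel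
  rw [residualSq, residualSq, h₁, h₂, h₃, norm_add_sq_real, norm_add_sq_real (σ.div - τ.div),
    norm_add_sq_real (σ.flux - τ.flux)]
  have hσ := hτ σ
  have hτ := hτ τ
  simp only [inner_sub_left, inner_sub_right, inner_add_left, inner_add_right] at *
  rw [real_inner_comm τ.field σ.field, real_inner_comm q.grad σ.field,
    real_inner_comm q.grad τ.field, real_inner_comm τ.div σ.div, real_inner_comm f σ.div,
    real_inner_comm f τ.div, real_inner_comm τ.flux σ.flux, real_inner_comm g σ.flux,
    real_inner_comm v σ.flux, real_inner_comm g τ.flux, real_inner_comm v τ.flux] at *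
  linarith

/-! ### Part (b): the optimal `β` for a fixed flux -/

theorem residualSq_nonneg (τ : HDivN Ω ΓD) : 0 ≤ residualSq cΩ cΓ f g v τ := by
  unfold residualSq
  positivity

theorem betaHat_pos {τ : HDivN Ω ΓD} (hτ : τ.field ≠ q.grad)
    (h : residualSq cΩ cΓ f g v τ ≠ 0) : 0 < betaHat cΩ cΓ f g v q τ :=
  div_pos (Real.sqrt_pos.2 ((residualSq_nonneg τ).lt_of_ne' h)) (norm_sub_pos_iff.2 hτ)

theorem JUpper_betaHat_le {τ : HDivN Ω ΓD} (hτ : τ.field ≠ q.grad)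
    (h : residualSq cΩ cΓ f g v τ ≠ 0) (hβ : 0 < β) :
    JUpper cΩ cΓ α f g v ud q τ (betaHat cΩ cΓ f g v q τ) ≤ JUpper cΩ cΓ α f g v ud q τ β := by
  have hN : 0 < ‖τ.field - q.grad‖ := norm_sub_pos_iff.2 hτ
  have hR : 0 < √(residualSq cΩ cΓ f g v τ) :=
    Real.sqrt_pos.2 ((residualSq_nonneg τ).lt_of_ne' h)
  have hsq := Real.sq_sqrt (residualSq_nonneg (cΩ := cΩ) (cΓ := cΓ) (f := f) (g := g) (v := v) τ)
  unfold JUpper betaHat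
  -- Everything is now expressed through `R`, the square root of the residual; `Real.sqrt_sq` undoes
  -- the substitution under the root in `betaHat`.
  rw [← hsq, Real.sqrt_sq hR.le]
  generalize ‖τ.field - q.grad‖ = N at *
  generalize √(residualSq cΩ cΓ f g v τ) = R at *
  have e₁ : (1 + R / N) * N ^ 2 + (1 + R / N) / (R / N) * R ^ 2 = (N + R) ^ 2 := by
    field_simp
  have e₂ : (1 + β) * N ^ 2 + (1 + β) / β * R ^ 2 = (N + R) ^ 2 + (β * N - R) ^ 2 / β := by
    field_simp
    ring
  rw [e₁, e₂]
  have : 0 ≤ (β * N - R) ^ 2 / β := by positivity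
  linarith

theorem JUpper_of_residualSq_eq_zero {τ : HDivN Ω ΓD}
    (h : residualSq cΩ cΓ f g v τ = 0) (β : ℝ) :
    JUpper cΩ cΓ α f g v ud q τ β = (1 + β) * ‖τ.field - q.grad‖ ^ 2 + α * ‖v - ud‖ ^ 2 := by
  simp [JUpper, h]

theorem tendsto_JUpper_of_residualSq_eq_zero {τ : HDivN Ω ΓD}
    (h : residualSq cΩ cΓ f g v τ = 0) :
    Tendsto (fun β => JUpper cΩ cΓ α f g v ud q τ β) (𝓝[>] 0)
      (𝓝 (‖τ.field - q.grad‖ ^ 2 + α * ‖v - ud‖ ^ 2)) := by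
  simp only [JUpper_of_residualSq_eq_zero h]
  have hc : Continuous fun β : ℝ =>
      (1 + β) * ‖τ.field - q.grad‖ ^ 2 + α * ‖v - ud‖ ^ 2 := by fun_prop
  simpa using (hc.tendsto 0).mono_left nhdsWithin_le_nhds

theorem isGLB_JUpper_of_residualSq_eq_zero {τ : HDivN Ω ΓD}
    (h : residualSq cΩ cΓ f g v τ = 0) :
    IsGLB ((fun β => JUpper cΩ cΓ α f g v ud q τ β) '' Ioi 0)
      (‖τ.field - q.grad‖ ^ 2 + α * ‖v - ud‖ ^ 2) := by
  -- The excess over the claimed infimum is `β N² ≥ 0`; any lower bound passes to the limit `β →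
  -- 0+`.
  refine ⟨?_, fun b hb => ge_of_tendsto (tendsto_JUpper_of_residualSq_eq_zero h) ?_⟩
  · rintro _ ⟨β, hβ, rfl⟩
    simp only [JUpper_of_residualSq_eq_zero h]
    have : 0 ≤ β * ‖τ.field - q.grad‖ ^ 2 := mul_nonneg (le_of_lt hβ) (by positivity)
    linarith
  · filter_upwards [self_mem_nhdsWithin] with β hβ
    exact hb (mem_image_of_mem _ hβ)

end BoundaryControl

theorem mainTheorem6 {d : ℕ} (Ω ΓD : Set (BoundaryControl.Space d))
    (hΩ_open : IsOpen Ω) (hΩ_sc : SimplyConnectedSpace Ω)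
    (hΩ_lip : BoundaryControl.HasLipschitzBoundary Ω)
    (hΓD_closed : IsClosed ΓD) (hΓD_sub : ΓD ⊆ frontier Ω)
    (hΓD_pos : 0 < BoundaryControl.surfaceMeasure d ΓD)
    (cΩ cΓ α : ℝ) (hcΩ_pos : 0 < cΩ) (hcΓ_pos : 0 < cΓ) (hα : 0 < α)
    (hcΩ : BoundaryControl.IsFriedrichsConstant Ω ΓD cΩ)
    (hcΓ : BoundaryControl.IsTraceConstant Ω ΓD cΓ)
    (f : BoundaryControl.L2 Ω) (g v ud : BoundaryControl.L2Neumann Ω ΓD)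
    (q : BoundaryControl.V0 Ω ΓD) :
    (∀ β : ℝ, 0 < β →
      (∃! τ : BoundaryControl.HDivN Ω ΓD,
        BoundaryControl.SolvesFluxProblem cΩ cΓ f g v q β τ) ∧
      ∀ τ : BoundaryControl.HDivN Ω ΓD,
        BoundaryControl.SolvesFluxProblem cΩ cΓ f g v q β τ →
        IsLeast (range fun σ : BoundaryControl.HDivN Ω ΓD =>
            BoundaryControl.JUpper cΩ cΓ α f g v ud q σ β)
          (BoundaryControl.JUpper cΩ cΓ α f g v ud q τ β)) ∧
    (∀ τ : BoundaryControl.HDivN Ω ΓD, τ.field ≠ q.grad →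
      (BoundaryControl.residualSq cΩ cΓ f g v τ ≠ 0 →
        0 < BoundaryControl.betaHat cΩ cΓ f g v q τ ∧
        IsLeast ((fun β => BoundaryControl.JUpper cΩ cΓ α f g v ud q τ β) '' Ioi 0)
          (BoundaryControl.JUpper cΩ cΓ α f g v ud q τ
            (BoundaryControl.betaHat cΩ cΓ f g v q τ))) ∧
      (BoundaryControl.residualSq cΩ cΓ f g v τ = 0 →
        BoundaryControl.betaHat cΩ cΓ f g v q τ = 0 ∧
        IsGLB ((fun β => BoundaryControl.JUpper cΩ cΓ α f g v ud q τ β) '' Ioi 0)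
          (‖τ.field - q.grad‖ ^ 2 + α * ‖v - ud‖ ^ 2) ∧
        Tendsto (fun β => BoundaryControl.JUpper cΩ cΓ α f g v ud q τ β) (𝓝[>] 0)
          (𝓝 (‖τ.field - q.grad‖ ^ 2 + α * ‖v - ud‖ ^ 2)))) := by
  refine ⟨fun β hβ => ⟨?_, fun τ hτ => ⟨mem_range_self τ, ?_⟩⟩, fun τ hτ =>
    ⟨fun h => ⟨BoundaryControl.betaHat_pos hτ h, mem_image_of_mem _
        (BoundaryControl.betaHat_pos hτ h), ?_⟩,
      fun h => ⟨by simp [BoundaryControl.betaHat, h],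
        BoundaryControl.isGLB_JUpper_of_residualSq_eq_zero h,
        BoundaryControl.tendsto_JUpper_of_residualSq_eq_zero h⟩⟩⟩
  · obtain ⟨τ, hτ⟩ :=
      BoundaryControl.exists_solvesFluxProblem hcΓ hcΩ_pos hcΓ_pos hβ f g v q
    exact ⟨τ, hτ, fun σ hσ => hσ.unique hcΩ_pos hcΓ_pos hβ hτ⟩
  · rintro _ ⟨σ, rfl⟩
    exact hτ.JUpper_le hβ σ
  · rintro _ ⟨β, hβ, rfl⟩
    exact BoundaryControl.JUpper_betaHat_le hτ h hβ
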